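/- **Proposition 2.1.** Let $X$ be a complete, non-compact Alexandrov space of non-negative curvature and of finite Hausdorff dimension $n$ (that is, a complete metric space in which any two points are joined by a geodesic — a unit-speed curve whose length is the distance of its endpoints — and in which every geodesic triangle is at least as fat as its comparison triangle in the Euclidean plane). Let $x_0\in X$, $B_t(x_0)=\{y : d(x_0,y)<t\}$. Then $\partial B_t(x_0)\neq\emptyset$ for all $t>0$, and the limit $$h(x)=\lim_{t\to+\infty}\big[d(x,\partial B_t(x_0))-t\big]$$ exists in $\mathbb R$ for every $x\in X$ ($h$ is the Busemann function). Moreover: 1. $h$ is concave along quasi-geodesics: for every quasi-geodesic $\sigma:[a,b]\to X$ of unit speed, $t\mapsto h(\sigma(t))$ is concave on $[a,b]$. It is likewise concave along every geodesic. 2. For every $c\in\mathbb R$ the superlevel set $\Omega_c=h^{-1}([c,+\infty))$ is totally convex: if $\sigma:[a,b]\to X$ is a quasi-geodesic of unit speed with $\sigma(a),\sigma(b)\in\Omega_c$, then $\sigma([a,b])\subset\Omega_c$. Here a curve $\sigma:[a,b]\to X$ parametrized by arclength is a quasi-geodesic if for every $p\in X$ and every $s\in[a,b]$ with $\sigma(s)\ne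 p$, the Euclidean comparison angle between the sides $d(p,\sigma(s))$ and $u$, opposite to the side $d(p,\sigma(s+u))$, is non-increasing in $u\in(0,b-s]$, and likewise with $\sigma(s-u)$ for $u\in(0,s-a]$. (The comparison angle between sides $\alpha,\beta>0$ opposite to $\gamma$ is the arccosine of $(\alpha^2+\beta^2-\gamma^2)/(2\alpha\beta)$, this number being replaced by $1$ if it exceeds $1$ and by $-1$ if it is below $-1$.) -/

import Mathlib

open Set Filter Topology

/-- `σ` restricted to `[a, b]` is a geodesic: a length-minimizing curve of unit speed. -/
def IsGeodesicOn {X : Type*} [MetricSpace X] (σ : ℝ → X) (a b : ℝ) : Prop :=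
  a ≤ b ∧ ∀ s ∈ Icc a b, ∀ t ∈ Icc a b, dist (σ s) (σ t) = |s - t|

/-- A complete Alexandrov space of non-negative curvature: a complete metric space in which any two
points are joined by a geodesic and every geodesic triangle is at least as fat as its comparison
triangle `p' x' y'` in the Euclidean plane: the distance from the vertex `p` to a point `z` of the
opposite side is at least the corresponding distance in the plane.
In a geodesic space, the points `z` with `dist x z + dist z y = dist x y` are precisely the points
of the geodesics from `x` to `y`. -/
structure IsNonnegAlexandrovSpace (X : Type*) [MetricSpace X] : Prop where
  complete : CompleteSpace X
  exists_geodesic : ∀ x y : X, ∃ σ : ℝ → X,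
    IsGeodesicOn σ 0 (dist x y) ∧ σ 0 = x ∧ σ (dist x y) = y
  comparison : ∀ (p x y z : X) (p' x' y' z' : EuclideanSpace ℝ (Fin 2)),
    dist p' x' = dist p x → dist p' y' = dist p y → dist x' y' = dist x y →
    dist x z + dist z y = dist x y → dist x' z' = dist x z → dist z' y' = dist z y →
    dist p' z' ≤ dist p z

/-- In a Euclidean triangle with sides `a, b, c`, where `0 < a` and `0 < b`, the angle opposite to
the side `c`. As `Real.arccos` is constant outside `[-1, 1]`, the angle is `0` if `c < |a - b|`. -/
noncomputable def comparisonAngle (a b c : ℝ) : ℝ :=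
  Real.arccos ((a ^ 2 + b ^ 2 - c ^ 2) / (2 * a * b))

/-- `σ : [a, b] → X` is a quasi-geodesic in a space of non-negative curvature: it is parametrized
by arclength, and for each point `p` and each parameter `s` with `σ s ≠ p`, the comparison angle
opposite to `dist p (σ (s ± u))` in the triangle with sides `dist p (σ s)`, `u`,
`dist p (σ (s ± u))` does not increase with `u`. -/
structure IsQuasiGeodesicOn {X : Type*} [MetricSpace X] (σ : ℝ → X) (a b : ℝ) : Prop where
  le : a ≤ b
  unitSpeed : HasUnitSpeedOn σ (Icc a b)
  forward : ∀ p : X, ∀ s ∈ Icc a b, σ s ≠ p →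
    AntitoneOn (fun u => comparisonAngle (dist p (σ s)) u (dist p (σ (s + u)))) (Ioc 0 (b - s))
  backward : ∀ p : X, ∀ s ∈ Icc a b, σ s ≠ p →
    AntitoneOn (fun u => comparisonAngle (dist p (σ s)) u (dist p (σ (s - u)))) (Ioc 0 (s - a))

/-- Totally convex sets: each quasi-geodesic with both endpoints in `A` stays in `A`. -/
def IsTotallyConvex {X : Type*} [MetricSpace X] (A : Set X) : Prop :=
  ∀ (a b : ℝ) (σ : ℝ → X), IsQuasiGeodesicOn σ a b → σ a ∈ A → σ b ∈ A →
    ∀ t ∈ Icc a b, σ t ∈ A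

/-- The function `x ↦ d(x, ∂B_t(x₀)) - t`. -/
noncomputable def preBusemann {X : Type*} [MetricSpace X] (x₀ x : X) (t : ℝ) : ℝ :=
  Metric.infDist x (frontier (Metric.ball x₀ t)) - t

/-- The Busemann function `h(x) = lim_{t → ∞} [d(x, ∂B_t(x₀)) - t]`. -/
noncomputable def busemann {X : Type*} [MetricSpace X] (x₀ x : X) : ℝ :=
  limUnder atTop (preBusemann x₀ x)

/-! Comparison says that squared distances are at most as convex along `σ` as in the plane. For
points at distance about `t` from `σ`, taking square roots divides the defect by about `t`, so
distances, and hence distances to `∂B_t`, are concave up to `O(1/t)`; this vanishes in the limit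
(`sub_div_le_of_sq_ge`, `concaveOn_busemann_comp`). The limit exists by monotonicity and boundedness
(`tendsto_preBusemann`). Spheres are non-empty because `X` is unbounded: otherwise `X` contains an
infinite separated sequence, contractions copy it near every point at every scale, and the resulting
trees force infinite dimension (`exists_dist_gt`). -/

/-! ### Comparison inequalities in Stewart's form. -/

/-- Stewart's theorem in the Euclidean plane, together with the existence of the triangle. -/
theorem exists_plane_triangle_with_cevian {a b c l : ℝ} (ha : 0 ≤ a) (hb : 0 ≤ b) (hc : 0 ≤ c)
    (hab : a ≤ b + c) (hba : b ≤ a + c) (hcab : c ≤ a + b) (hl0 : 0 ≤ l) (hl1 : l ≤ 1) :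
    ∃ p x y z : EuclideanSpace ℝ (Fin 2), dist p x = a ∧ dist p y = b ∧ dist x y = c ∧
      dist x z = l * c ∧ dist z y = (1 - l) * c ∧
      dist p z ^ 2 = (1 - l) * a ^ 2 + l * b ^ 2 - l * (1 - l) * c ^ 2 := by
  -- With `x` at the origin and `y = (c, 0)`, `u` is the abscissa of `p`; it is arbitrary within
  -- `[-a, a]` if `c = 0`.
  obtain ⟨u, hu, hua⟩ : ∃ u : ℝ, 2 * c * u = a ^ 2 + c ^ 2 - b ^ 2 ∧ u ^ 2 ≤ a ^ 2 := by
    rcases hc.eq_or_lt with rfl | hc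
    · obtain rfl : a = b := by linarith
      exact ⟨0, by ring, by nlinarith⟩
    · have key : 2 * c * ((a ^ 2 + c ^ 2 - b ^ 2) / (2 * c)) = a ^ 2 + c ^ 2 - b ^ 2 := by
        field_simp
      refine ⟨_, key, ?_⟩
      set u := (a ^ 2 + c ^ 2 - b ^ 2) / (2 * c)
      apply sq_le_sq'
      · have : 0 ≤ 2 * c * (u + a) := by nlinarith
        have := nonneg_of_mul_nonneg_right this (by positivity)
        linarith
      · have : 0 ≤ 2 * c * (a - u) := by nlinarith
        have := nonneg_of_mul_nonneg_right this (by positivity)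
        linarith
  have hv : Real.sqrt (a ^ 2 - u ^ 2) ^ 2 = a ^ 2 - u ^ 2 := Real.sq_sqrt (by linarith)
  set v := Real.sqrt (a ^ 2 - u ^ 2)
  have hd : ∀ r s r' s' d : ℝ, 0 ≤ d → (r - r') ^ 2 + (s - s') ^ 2 = d ^ 2 →
      dist (!₂[r, s] : EuclideanSpace ℝ (Fin 2)) !₂[r', s'] = d := by
    intro r s r' s' d h0 h
    rw [EuclideanSpace.dist_eq]
    simp [Fin.sum_univ_two, Real.dist_eq, sq_abs, h, Real.sqrt_sq h0]
  refine ⟨!₂[u, v], !₂[0, 0], !₂[c, 0], !₂[l * c, 0], hd _ _ _ _ _ ha (by linarith),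
    hd _ _ _ _ _ hb (by linarith), hd _ _ _ _ _ hc (by ring),
    hd _ _ _ _ _ (by positivity) (by ring),
    hd _ _ _ _ _ (mul_nonneg (by linarith) hc) (by ring), ?_⟩
  have h0 : 0 ≤ (u - l * c) ^ 2 + (v - 0) ^ 2 := by positivity
  rw [hd _ _ _ _ _ (Real.sqrt_nonneg _) (Real.sq_sqrt h0).symm, Real.sq_sqrt h0]
  linear_combination hv - l * hu

section

variable {X : Type*} [MetricSpace X]

namespace IsNonnegAlexandrovSpace

theorem sq_dist_ge (hX : IsNonnegAlexandrovSpace X) (p x y z : X) {l : ℝ} (hl0 : 0 ≤ l)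
    (hl1 : l ≤ 1) (hxz : dist x z = l * dist x y) (hzy : dist z y = (1 - l) * dist x y) :
    (1 - l) * dist p x ^ 2 + l * dist p y ^ 2 - l * (1 - l) * dist x y ^ 2 ≤ dist p z ^ 2 := by
  obtain ⟨p', x', y', z', h1, h2, h3, h4, h5, h6⟩ := exists_plane_triangle_with_cevian
    (a := dist p x) (b := dist p y) (c := dist x y) dist_nonneg dist_nonneg dist_nonneg
    (by simpa [dist_comm x y] using dist_triangle p y x) (dist_triangle p x y)
    (by simpa [dist_comm x p] using dist_triangle x p y) hl0 hl1
  rw [← h6]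
  gcongr
  exact hX.comparison p x y z p' x' y' z' h1 h2 h3 (by rw [hxz, hzy]; ring)
    (by rw [h4, hxz]) (by rw [h5, hzy])

theorem exists_dist_eq_mul (hX : IsNonnegAlexandrovSpace X) (x y : X) {l : ℝ} (hl0 : 0 ≤ l)
    (hl1 : l ≤ 1) : ∃ z, dist x z = l * dist x y ∧ dist z y = (1 - l) * dist x y := by
  obtain ⟨σ, ⟨-, hσ⟩, h0, h1⟩ := hX.exists_geodesic x y
  have hd : 0 ≤ dist x y := dist_nonneg
  have hm : l * dist x y ∈ Icc 0 (dist x y) := ⟨by positivity, mul_le_of_le_one_left hd hl1⟩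
  refine ⟨σ (l * dist x y), ?_, ?_⟩
  · have := hσ 0 (left_mem_Icc.2 hd) _ hm
    rw [h0] at this
    rw [this, zero_sub, abs_neg, abs_of_nonneg hm.1]
  · have := hσ _ hm _ (right_mem_Icc.2 hd)
    rw [h1] at this
    rw [this, abs_of_nonpos (by linarith [hm.2])]
    ring

/-- The contraction by the factor `l` towards `p` is expanding, up to this factor. -/
theorem mul_dist_le_of_contraction (hX : IsNonnegAlexandrovSpace X) {p x y x' y' : X} {l : ℝ}
    (hl0 : 0 ≤ l) (hl1 : l ≤ 1) (hx : dist p x' = l * dist p x)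
    (hx' : dist x' x = (1 - l) * dist p x) (hy : dist p y' = l * dist p y)
    (hy' : dist y' y = (1 - l) * dist p y) : l * dist x y ≤ dist x' y' := by
  -- Move one endpoint at a time; in `l * h1 + h2` the terms in `dist p x` and `dist p y` cancel.
  have h1 := hX.sq_dist_ge y p x x' hl0 hl1 hx hx'
  have h2 := hX.sq_dist_ge x' p y y' hl0 hl1 hy hy'
  rw [dist_comm x' p, hx, dist_comm x' y] at h2
  rw [dist_comm y p, dist_comm y x] at h1
  refine le_of_sq_le_sq ?_ dist_nonneg
  nlinarith [mul_le_mul_of_nonneg_left h1 hl0]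

/-! ### Spheres and existence of the limit. -/

theorem sphere_subset_frontier (hX : IsNonnegAlexandrovSpace X) (x₀ : X) {t : ℝ} (ht : 0 < t) :
    Metric.sphere x₀ t ⊆ frontier (Metric.ball x₀ t) := by
  intro y hy
  rw [Metric.mem_sphere'] at hy
  rw [Metric.isOpen_ball.frontier_eq]
  refine ⟨Metric.mem_closure_iff.2 fun ε hε => ?_, by simp [dist_comm y x₀, hy]⟩
  have hδ : 0 < min (ε / 2) t := lt_min (by positivity) ht
  obtain ⟨z, hz, hz'⟩ := hX.exists_dist_eq_mul x₀ y (l := 1 - min (ε / 2) t / t)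
    (by rw [sub_nonneg, div_le_one ht]; exact min_le_right _ _)
    (by linarith [div_pos hδ ht])
  rw [hy, sub_mul, div_mul_cancel₀ _ ht.ne', one_mul] at hz
  rw [hy, sub_sub_cancel, div_mul_cancel₀ _ ht.ne'] at hz'
  refine ⟨z, by rw [Metric.mem_ball', hz]; linarith, ?_⟩
  rw [dist_comm, hz']
  linarith [min_le_left (ε / 2) t]

/-- A geodesic from inside a ball to a point outside it crosses the sphere. -/
theorem exists_mem_sphere_between (hX : IsNonnegAlexandrovSpace X) {x₀ x y : X} {t : ℝ}
    (hx : dist x x₀ ≤ t) (hy : t ≤ dist y x₀) :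
    ∃ z ∈ Metric.sphere x₀ t, dist x z + dist z y = dist x y := by
  obtain ⟨σ, ⟨-, hσ⟩, h0, h1⟩ := hX.exists_geodesic x y
  have hd : 0 ≤ dist x y := dist_nonneg
  have hc : ContinuousOn σ (Icc 0 (dist x y)) :=
    (LipschitzOnWith.of_dist_le_mul (K := 1) fun s hs r hr => by
      simpa [Real.dist_eq] using (hσ s hs r hr).le).continuousOn
  have hc' : ContinuousOn (fun u => dist (σ u) x₀) (Icc 0 (dist x y)) :=
    (continuous_id.dist continuous_const).comp_continuousOn hc
  obtain ⟨u, hu, hut⟩ := intermediate_value_Icc hd hc' (show t ∈ Icc _ _ by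
    simp only [h0, h1]; exact ⟨hx, hy⟩)
  refine ⟨σ u, hut, ?_⟩
  have e0 := hσ 0 (left_mem_Icc.2 hd) u hu
  have e1 := hσ u hu _ (right_mem_Icc.2 hd)
  rw [h0, zero_sub, abs_neg, abs_of_nonneg hu.1] at e0
  rw [h1, abs_of_nonpos (by linarith [hu.2])] at e1
  rw [e0, e1]
  ring

/-- A geodesic from `x` to the larger sphere crosses the smaller one, and then has length at least
`s - t` left. -/
theorem preBusemann_mono (hX : IsNonnegAlexandrovSpace X) {x₀ : X}
    (hne : ∀ t : ℝ, 0 < t → (frontier (Metric.ball x₀ t)).Nonempty) {x : X} {s t : ℝ}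
    (ht : 0 < t) (hx : dist x x₀ ≤ t) (hts : t ≤ s) :
    preBusemann x₀ x t ≤ preBusemann x₀ x s := by
  unfold preBusemann
  have hs : 0 < s := ht.trans_le hts
  suffices h : Metric.infDist x (frontier (Metric.ball x₀ t)) + (s - t) ≤
      Metric.infDist x (frontier (Metric.ball x₀ s)) by linarith
  refine (Metric.le_infDist (hne s hs)).2 fun q hq => ?_
  have hq' := Metric.frontier_ball_subset_sphere hq
  rw [Metric.mem_sphere] at hq'
  obtain ⟨z, hz, hzq⟩ := hX.exists_mem_sphere_between hx (hts.trans hq'.ge)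
  have h1 := Metric.infDist_le_dist_of_mem (x := x) (hX.sphere_subset_frontier x₀ ht hz)
  have h2 := dist_triangle q z x₀
  rw [Metric.mem_sphere] at hz
  rw [dist_comm q z] at h2
  linarith

theorem tendsto_preBusemann (hX : IsNonnegAlexandrovSpace X) {x₀ : X}
    (hne : ∀ t : ℝ, 0 < t → (frontier (Metric.ball x₀ t)).Nonempty) (x : X) :
    Tendsto (preBusemann x₀ x) atTop (𝓝 (busemann x₀ x)) := by
  -- Monotonicity holds only from `dist x x₀` on, so the radius is truncated below at `T`; the `1`
  -- keeps it positive.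
  set T := max (dist x x₀) 1 with hT
  have hT0 : 0 < T := lt_max_of_lt_right one_pos
  have hmono : Monotone fun t => preBusemann x₀ x (max t T) := fun t s hts =>
    hX.preBusemann_mono hne (lt_max_of_lt_right hT0)
      ((le_max_left _ _).trans (le_max_right _ _)) (max_le_max_right T hts)
  have hbdd : BddAbove (range fun t => preBusemann x₀ x (max t T)) := by
    refine ⟨dist x x₀, ?_⟩
    rintro _ ⟨t, rfl⟩
    obtain ⟨q, hq⟩ := hne (max t T) (lt_max_of_lt_right hT0)
    have h1 := Metric.infDist_le_dist_of_mem (x := x) hq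
    have hq' := Metric.frontier_ball_subset_sphere hq
    rw [Metric.mem_sphere'] at hq'
    have h2 := dist_triangle x x₀ q
    simp only [preBusemann]
    linarith
  refine tendsto_nhds_limUnder ⟨_, (tendsto_atTop_ciSup hmono hbdd).congr' ?_⟩
  filter_upwards [eventually_ge_atTop T] with t ht
  rw [max_eq_left ht]

end IsNonnegAlexandrovSpace

/-! ### Concavity of the Busemann function along curves. -/

/-- If `f` fell short of the mean `m` by more than `L ^ 2 / D`, then `m ^ 2 - f ^ 2 = (m - f) * (m +
f)` would exceed `L ^ 2`, as `m ≥ D`. -/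
theorem sub_div_le_of_sq_ge {A B f α β L D : ℝ} (hA : D ≤ A) (hB : D ≤ B) (hD : 0 < D)
    (hf : 0 ≤ f) (hα : 0 ≤ α) (hβ : 0 ≤ β) (hαβ : α + β = 1)
    (h : α * A ^ 2 + β * B ^ 2 - α * β * L ^ 2 ≤ f ^ 2) :
    α * A + β * B - L ^ 2 / D ≤ f := by
  obtain rfl : β = 1 - α := by linarith
  by_contra! hlt
  set m := α * A + (1 - α) * B with hm
  have hmD : D ≤ m := by nlinarith
  have hq : 0 ≤ L ^ 2 / D := by positivity
  have hqD : L ^ 2 / D * D = L ^ 2 := div_mul_cancel₀ _ hD.ne'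
  have h1 : L ^ 2 < (m - f) * D := by nlinarith
  have h2 : (m - f) * D ≤ (m - f) * (m + f) := by
    apply mul_le_mul_of_nonneg_left <;> linarith
  have h3 : m ^ 2 ≤ α * A ^ 2 + (1 - α) * B ^ 2 := by
    have : 0 ≤ α * (1 - α) * (A - B) ^ 2 := by positivity
    rw [hm]; nlinarith
  have h4 : α * (1 - α) * L ^ 2 ≤ L ^ 2 :=
    mul_le_of_le_one_left (sq_nonneg L) (by nlinarith)
  nlinarith

/-- If the squared distances from remote points are at most as convex along `σ` as along a
straight line, then the Busemann function is concave along `σ`. -/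
theorem concaveOn_busemann_comp {x₀ : X}
    (hne : ∀ t : ℝ, 0 < t → (frontier (Metric.ball x₀ t)).Nonempty)
    (hlim : ∀ x : X, Tendsto (preBusemann x₀ x) atTop (𝓝 (busemann x₀ x)))
    {σ : ℝ → X} {a b : ℝ} (hab : a ≤ b) (hσ : ∀ s ∈ Icc a b, dist (σ a) (σ s) ≤ b - a)
    (hsq : ∀ p : X, (∀ s ∈ Icc a b, 0 < dist p (σ s) ∧ b - a ≤ dist p (σ s)) →
      ∀ x ∈ Icc a b, ∀ y ∈ Icc a b, x < y → ∀ α β : ℝ, 0 < α → 0 < β → α + β = 1 →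
        α * dist p (σ x) ^ 2 + β * dist p (σ y) ^ 2 - α * β * (y - x) ^ 2 ≤
          dist p (σ (α * x + β * y)) ^ 2) :
    ConcaveOn ℝ (Icc a b) fun t => busemann x₀ (σ t) := by
  refine LinearOrder.concaveOn_of_lt (convex_Icc a b) ?_
  intro x hx y hy hxy α β hα hβ hαβ
  simp only [smul_eq_mul]
  -- `C` bounds the distance from `x₀` to every point of `σ`.
  set C := dist x₀ (σ a) + (b - a) with hC
  have hm : α * x + β * y ∈ Icc a b := convex_Icc a b hx hy hα.le hβ.le hαβ
  have hdiv : Tendsto (fun t : ℝ => (y - x) ^ 2 / (t - C)) atTop (𝓝 0) :=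
    (tendsto_atTop_add_const_right atTop (-C) tendsto_id).const_div_atTop _
  have hl := (((hlim (σ x)).const_mul α).add ((hlim (σ y)).const_mul β)).sub hdiv
  rw [sub_zero] at hl
  refine le_of_tendsto_of_tendsto hl (hlim _) ?_
  filter_upwards [eventually_gt_atTop (C + (b - a)), eventually_gt_atTop 0] with t ht ht0
  unfold preBusemann
  set F := frontier (Metric.ball x₀ t) with hF
  suffices h : α * Metric.infDist (σ x) F + β * Metric.infDist (σ y) F - (y - x) ^ 2 / (t - C) ≤
      Metric.infDist (σ (α * x + β * y)) F by
    obtain rfl : β = 1 - α := by linarith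
    linarith
  refine (Metric.le_infDist (hne t ht0)).2 fun q hq => ?_
  have hq' := Metric.frontier_ball_subset_sphere hq
  rw [Metric.mem_sphere] at hq'
  have hfar : ∀ s ∈ Icc a b, t - C ≤ dist q (σ s) := fun s hs => by
    have h1 := dist_triangle4_right q x₀ (σ s) (σ a)
    have h2 := hσ s hs
    have h3 := dist_triangle q (σ s) x₀
    have h4 := dist_triangle_right (σ s) x₀ (σ a)
    rw [dist_comm (σ s) (σ a)] at h4
    linarith
  have key := sub_div_le_of_sq_ge (hfar x hx) (hfar y hy) (by linarith) dist_nonneg hα.le hβ.le hαβ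
    (hsq q (fun s hs => ⟨by linarith [hfar s hs], by linarith [hfar s hs]⟩) x hx y hy hxy α β hα hβ
      hαβ)
  rw [dist_comm q (σ (_ + _)), dist_comm q (σ x), dist_comm q (σ y)] at key
  have e1 := mul_le_mul_of_nonneg_left (Metric.infDist_le_dist_of_mem (x := σ x) hq) hα.le
  have e2 := mul_le_mul_of_nonneg_left (Metric.infDist_le_dist_of_mem (x := σ y) hq) hβ.le
  linarith

theorem HasUnitSpeedOn.dist_le {σ : ℝ → X} {a b x y : ℝ} (h : HasUnitSpeedOn σ (Icc a b))
    (hx : x ∈ Icc a b) (hy : y ∈ Icc a b) (hxy : x ≤ y) : dist (σ x) (σ y) ≤ y - x := by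
  have h1 := h hx hy
  have h2 := eVariationOn.edist_le σ (s := Icc a b ∩ Icc x y) ⟨hx, left_mem_Icc.2 hxy⟩
    ⟨hy, right_mem_Icc.2 hxy⟩
  rw [h1, edist_dist, NNReal.coe_one, one_mul, ENNReal.ofReal_le_ofReal_iff (by linarith)] at h2
  exact h2

theorem comparisonAngle_arg_mem {a u c : ℝ} (ha : 0 < a) (hu : 0 < u) (h1 : a ≤ c + u)
    (h2 : u ≤ c + a) (h3 : c ≤ a + u) : (a ^ 2 + u ^ 2 - c ^ 2) / (2 * a * u) ∈ Icc (-1) 1 := by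
  have hp : 0 < 2 * a * u := by positivity
  constructor
  · rw [le_div_iff₀ hp]
    nlinarith
  · rw [div_le_one hp]
    nlinarith

/-- Angle monotonicity between the parameters `β * (y - x)` and `y - x` is this inequality, by the
law of cosines. As `σ` need not be minimizing, `u` may violate the triangle inequality; `p` is taken
far away so that `arccos` is never clamped. -/
theorem IsQuasiGeodesicOn.sq_dist_ge {σ : ℝ → X} {a b : ℝ} (hσ : IsQuasiGeodesicOn σ a b) {p : X}
    (hp : ∀ s ∈ Icc a b, 0 < dist p (σ s) ∧ b - a ≤ dist p (σ s)) {x y α β : ℝ}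
    (hx : x ∈ Icc a b) (hy : y ∈ Icc a b) (hxy : x < y) (hα : 0 < α) (hβ : 0 < β)
    (hαβ : α + β = 1) :
    α * dist p (σ x) ^ 2 + β * dist p (σ y) ^ 2 - α * β * (y - x) ^ 2 ≤
      dist p (σ (α * x + β * y)) ^ 2 := by
  obtain ⟨hp0, hpx⟩ := hp x hx
  have hne : σ x ≠ p := fun h => by simp [h] at hp0
  have hxm : α * x + β * y = x + β * (y - x) := by
    obtain rfl : α = 1 - β := by linarith
    ring
  have hL : 0 < y - x := sub_pos.2 hxy
  have hu : 0 < β * (y - x) := by positivity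
  have huL : β * (y - x) ≤ y - x := mul_le_of_le_one_left hL.le (by linarith)
  have hmem : ∀ u, 0 < u → u ≤ y - x → (dist p (σ x) ^ 2 + u ^ 2 - dist p (σ (x + u)) ^ 2) /
      (2 * dist p (σ x) * u) ∈ Icc (-1) 1 := by
    intro u hu0 huy
    have hxu : x + u ∈ Icc a b := ⟨by linarith [hx.1], by linarith [hy.2]⟩
    have hd := hσ.unitSpeed.dist_le hx hxu (by linarith)
    have t1 := dist_triangle p (σ (x + u)) (σ x)
    have t2 := dist_triangle p (σ x) (σ (x + u))
    rw [dist_comm (σ (x + u)) (σ x)] at t1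
    have t3 : (0 : ℝ) ≤ dist p (σ (x + u)) := dist_nonneg
    exact comparisonAngle_arg_mem hp0 hu0 (by linarith) (by linarith [hx.1, hy.2]) (by linarith)
  have hanti := hσ.forward p x hx hne
    (show β * (y - x) ∈ Ioc 0 (b - x) from ⟨hu, by linarith [hy.2]⟩)
    (show y - x ∈ Ioc 0 (b - x) from ⟨hL, by linarith [hy.2]⟩) huL
  simp only [comparisonAngle] at hanti
  rw [Real.strictAntiOn_arccos.le_iff_ge (hmem _ hL le_rfl) (hmem _ hu huL),
    div_le_div_iff₀ (by positivity) (by positivity), add_sub_cancel x y] at hanti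
  rw [hxm]
  set A := dist p (σ x)
  set B := dist p (σ y)
  set f := dist p (σ (x + β * (y - x)))
  have hpos : 0 < 2 * A * (y - x) := by positivity
  have h3 : 2 * A * (y - x) * (A ^ 2 + (β * (y - x)) ^ 2 - f ^ 2) ≤
      2 * A * (y - x) * (β * (A ^ 2 + (y - x) ^ 2 - B ^ 2)) := by linarith
  have h4 := le_of_mul_le_mul_left h3 hpos
  obtain rfl : α = 1 - β := by linarith
  linarith

theorem IsGeodesicOn.sq_dist_ge (hX : IsNonnegAlexandrovSpace X) {σ : ℝ → X} {a b : ℝ}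
    (hσ : IsGeodesicOn σ a b) (p : X) {x y α β : ℝ}
    (hx : x ∈ Icc a b) (hy : y ∈ Icc a b) (hxy : x < y) (hα : 0 < α) (hβ : 0 < β)
    (hαβ : α + β = 1) :
    α * dist p (σ x) ^ 2 + β * dist p (σ y) ^ 2 - α * β * (y - x) ^ 2 ≤
      dist p (σ (α * x + β * y)) ^ 2 := by
  have hm : α * x + β * y ∈ Icc a b := convex_Icc a b hx hy hα.le hβ.le hαβ
  obtain rfl : α = 1 - β := by linarith
  have hL : 0 < y - x := sub_pos.2 hxy
  have dxy : dist (σ x) (σ y) = y - x := by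
    rw [hσ.2 x hx y hy, abs_of_neg (by linarith)]; ring
  have h := hX.sq_dist_ge p (σ x) (σ y) (σ ((1 - β) * x + β * y)) (l := β) hβ.le (by linarith)
    (by
      rw [hσ.2 x hx _ hm, dxy, abs_of_nonpos (by nlinarith [mul_pos hβ hL])]; ring)
    (by
      rw [hσ.2 _ hm y hy, dxy, abs_of_nonpos (by nlinarith [mul_pos hα hL])]; ring)
  rw [dxy] at h
  linarith

/-! ### Lower bounds for the Hausdorff dimension. -/

/-- A map from the sequences of `M ^ m` digits such that the images of sequences that first differ
at the `k`-th digit have distance at least a multiple of `M⁻¹ ^ k` has an image of Hausdorff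
dimension at least `m`. -/
theorem le_dimH_of_separated_digits {M m : ℕ} (hM : 1 < M) (hm : m ≠ 0)
    {g : (ℕ → Fin (M ^ m)) → X} {c : ℝ} (hc : 0 < c)
    (hg : ∀ v w : ℕ → Fin (M ^ m), ∀ k, (∀ i < k, v i = w i) → v k ≠ w k →
      c * (M : ℝ)⁻¹ ^ k ≤ dist (g v) (g w)) :
    (m : ENNReal) ≤ dimH (univ : Set X) := by
  have hN : 1 < M ^ m := Nat.one_lt_pow hm hM
  have hM0 : (0 : ℝ) < M := by positivity
  have hfirst : ∀ v w : ℕ → Fin (M ^ m), v ≠ w → ∃ k, (∀ i < k, v i = w i) ∧ v k ≠ w k := by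
    intro v w hvw
    have hex : ∃ k, v k ≠ w k := Function.ne_iff.1 hvw
    classical
    exact ⟨Nat.find hex, fun i hi => not_not.1 (Nat.find_min hex hi), Nat.find_spec hex⟩
  have hinj : Function.Injective g := by
    intro v w hvw
    by_contra hne
    obtain ⟨k, hk, hk'⟩ := hfirst v w hne
    have := hg v w k hk hk'
    rw [hvw, dist_self] at this
    have : 0 < c * (M : ℝ)⁻¹ ^ k := by positivity
    linarith
  have : Nonempty (ℕ → Fin (M ^ m)) := ⟨fun _ => ⟨0, by omega⟩⟩
  -- Reading the digits in base `M ^ m` maps `range g` onto `[0, 1]`, with Hölder exponent `m`.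
  set f : X → ℝ := Real.ofDigits ∘ Function.invFun g with hf
  have hfg : ∀ v, f (g v) = Real.ofDigits v := fun v => by
    simp [hf, Function.leftInverse_invFun hinj v]
  have hholder : HolderOnWith (Real.toNNReal (c⁻¹ ^ m)) m f (range g) := by
    rintro _ ⟨v, rfl⟩ _ ⟨w, rfl⟩
    rcases eq_or_ne v w with rfl | hvw
    · simp
    obtain ⟨k, hk, hk'⟩ := hfirst v w hvw
    have h1 := Real.abs_ofDigits_sub_ofDigits_le hk
    have h2 := hg v w k hk hk'
    have h3 : ((M ^ m : ℕ) ^ k : ℝ)⁻¹ ≤ c⁻¹ ^ m * dist (g v) (g w) ^ m := by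
      rw [← mul_pow]
      have : (M : ℝ)⁻¹ ^ k ≤ c⁻¹ * dist (g v) (g w) := by
        rw [inv_mul_eq_div, le_div_iff₀ hc]
        linarith
      calc ((M ^ m : ℕ) ^ k : ℝ)⁻¹ = ((M : ℝ)⁻¹ ^ k) ^ m := by
            push_cast
            rw [inv_pow, inv_pow, ← pow_mul, ← pow_mul, mul_comm]
        _ ≤ _ := by gcongr
    rw [hfg, hfg, edist_dist, edist_dist, Real.dist_eq, NNReal.coe_natCast, ENNReal.rpow_natCast,
      ← ENNReal.ofReal_pow dist_nonneg, ← ENNReal.ofReal.eq_1,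
      ← ENNReal.ofReal_mul (by positivity)]
    exact ENNReal.ofReal_le_ofReal (h1.trans h3)
  have hmpos : (0 : NNReal) < m := by positivity
  have hle := hholder.dimH_image_le hmpos
  have hsub : Icc (0 : ℝ) 1 ⊆ f '' range g := by
    intro t ht
    obtain ⟨v, -, rfl⟩ := Real.ofDigits_SurjOn hN ht
    exact ⟨g v, mem_range_self v, hfg v⟩
  have hone : dimH (Icc (0 : ℝ) 1) = 1 := by
    rw [Real.dimH_of_nonempty_interior (by simp [interior_Icc])]
    simp
  have h1 : 1 ≤ dimH (range g) / (m : NNReal) := hone ▸ (dimH_mono hsub).trans hle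
  rw [ENNReal.le_div_iff_mul_le (by simp [hm]) (by simp)] at h1
  simpa using h1.trans (dimH_mono (subset_univ _))

/-- A complete space in which each point `p` has, at each scale, arbitrarily many points that are
close to `p` and separated from each other, has infinite Hausdorff dimension. -/
theorem le_dimH_of_separated_at_all_scales [CompleteSpace X] [Nonempty X] {R ε : ℝ} (hR : 0 < R)
    (hε : 0 < ε) (y : X → ℝ → ℕ → X)
    (hy : ∀ p, ∀ l ∈ Ioc (0 : ℝ) 1, ∀ i, dist p (y p l i) ≤ R * l)
    (hy' : ∀ p, ∀ l ∈ Ioc (0 : ℝ) 1, ∀ i j, i ≠ j → ε * l ≤ dist (y p l i) (y p l j))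
    {m : ℕ} (hm : m ≠ 0) : (m : ENNReal) ≤ dimH (univ : Set X) := by
  -- After branching at level `k`, the two tails move by at most `4 * R * ρ ^ (k + 1) ≤ ε / 2 * ρ ^
  -- k` in total, which leaves half of the separation. `M` does not depend on `m`.
  obtain ⟨M, hMR⟩ := exists_nat_gt (max 2 (8 * R / ε))
  have hM2 : (2 : ℝ) < M := (le_max_left _ _).trans_lt hMR
  have hMR : 8 * R < ε * M := by
    have := (le_max_right _ _).trans_lt hMR
    rw [div_lt_iff₀ hε] at this
    linarith
  have hM0 : (0 : ℝ) < M := by linarith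
  set ρ : ℝ := (M : ℝ)⁻¹ with hρ
  have hρ0 : 0 < ρ := by positivity
  have hρ1 : ρ ≤ 1 / 2 := by
    rw [hρ, one_div]
    exact inv_anti₀ two_pos hM2.le
  have hρR : 8 * (R * ρ) ≤ ε := by
    have : M * ρ = 1 := mul_inv_cancel₀ hM0.ne'
    nlinarith
  have hl : ∀ k : ℕ, ρ ^ k ∈ Ioc (0 : ℝ) 1 := fun k =>
    ⟨by positivity, pow_le_one₀ hρ0.le (by linarith)⟩
  let z : (ℕ → Fin (M ^ m)) → ℕ → X := fun w k =>
    Nat.rec (Classical.arbitrary X) (fun j q => y q (ρ ^ j) (w j)) k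
  have hz : ∀ w k, z w (k + 1) = y (z w k) (ρ ^ k) (w k) := fun w k => rfl
  have hstep : ∀ w k, dist (z w k) (z w (k + 1)) ≤ R * ρ ^ k := fun w k => by
    rw [hz]; exact hy _ _ (hl k) _
  have hρ1' : ρ < 1 := by linarith
  have hlim : ∀ w, ∃ x, Tendsto (z w) atTop (𝓝 x) := fun w =>
    cauchySeq_tendsto_of_complete (cauchySeq_of_le_geometric ρ R hρ1' (hstep w))
  choose g hg using hlim
  have hdist : ∀ w k, dist (z w k) (g w) ≤ 2 * R * ρ ^ k := fun w k => by
    refine (dist_le_of_le_geometric_of_tendsto ρ R hρ1' (hstep w) (hg w) k).trans ?_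
    rw [div_le_iff₀ (by linarith)]
    have : 0 < R * ρ ^ k := by positivity
    nlinarith
  refine le_dimH_of_separated_digits (M := M) (m := m) (g := g) (c := ε / 2)
    (by exact_mod_cast (by linarith : (1 : ℝ) < M)) hm (by positivity) ?_
  intro v w k hk hk'
  have heq : ∀ j ≤ k, z v j = z w j := by
    intro j
    induction j with
    | zero => intro _; rfl
    | succ j ih =>
      intro hj
      rw [hz, hz, ih (by omega), hk j (by omega)]
  have h1 : ε * ρ ^ k ≤ dist (z v (k + 1)) (z w (k + 1)) := by
    rw [hz, hz, heq k le_rfl]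
    exact hy' _ _ (hl k) _ _ fun h => hk' (Fin.ext h)
  have h2 := dist_triangle4 (z v (k + 1)) (g v) (g w) (z w (k + 1))
  have h3 := hdist v (k + 1)
  have h4 := hdist w (k + 1)
  rw [dist_comm (z w (k + 1))] at h4
  have h5 : 8 * (R * ρ) * ρ ^ k ≤ ε * ρ ^ k := by gcongr
  rw [pow_succ] at h3 h4
  linarith

theorem exists_separated_seq_of_not_totallyBounded (h : ¬ TotallyBounded (univ : Set X)) :
    ∃ ε > 0, ∃ u : ℕ → X, ∀ i j, i ≠ j → ε ≤ dist (u i) (u j) := by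
  rw [Metric.totallyBounded_iff] at h
  push Not at h
  obtain ⟨ε, hε, h⟩ := h
  have : Std.Symm fun x y : X => ε ≤ dist x y := ⟨fun x y hxy => by rwa [dist_comm]⟩
  obtain ⟨u, -, hu⟩ := exists_seq_of_forall_finset_exists' (fun _ : X => True)
    (fun x y => ε ≤ dist x y) (fun s _ => by
      obtain ⟨y, -, hy⟩ := not_subset.1 (h s s.finite_toSet)
      refine ⟨y, trivial, fun x hx => ?_⟩
      simp only [mem_iUnion, Metric.mem_ball, not_exists, not_lt] at hy
      rw [dist_comm]
      exact hy x hx)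
  exact ⟨ε, hε, u, fun i j hij => hu hij⟩

/-! ### Unboundedness and non-empty spheres. -/

namespace IsNonnegAlexandrovSpace

/-- A non-compact space of non-negative curvature and of finite dimension is unbounded. -/
theorem exists_dist_gt [NoncompactSpace X] (hX : IsNonnegAlexandrovSpace X)
    (hdim : dimH (univ : Set X) ≠ ⊤) (x₀ : X) (r : ℝ) : ∃ y, r < dist y x₀ := by
  by_contra! hr
  have := hX.complete
  have hnt : ¬ TotallyBounded (univ : Set X) := fun h =>
    noncompact_univ X (isCompact_iff_totallyBounded_isComplete.2 ⟨h, isComplete_univ⟩)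
  obtain ⟨ε, hε, u, hu⟩ := exists_separated_seq_of_not_totallyBounded hnt
  have hr0 : 0 ≤ r := dist_nonneg.trans (hr x₀)
  have hR : ∀ x y : X, dist x y ≤ 2 * r + 1 := fun x y => by
    linarith [dist_triangle_right x y x₀, hr x, hr y]
  -- The copy at `p` of scale `l` is the contraction of `u` towards `p`.
  choose! z hz hz' using fun (p : X) (l : ℝ) (h : l ∈ Ioc (0 : ℝ) 1) (i : ℕ) =>
    hX.exists_dist_eq_mul p (u i) h.1.le h.2
  have : Nonempty X := ⟨x₀⟩
  obtain ⟨d, hd⟩ := ENNReal.exists_nat_gt hdim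
  refine (hd.trans_le (le_dimH_of_separated_at_all_scales (R := 2 * r + 1) (by linarith) hε z
    (fun p l hl i => ?_) (fun p l hl i j hij => ?_) (m := d) ?_)).false
  · rw [hz p l hl i, mul_comm]
    exact mul_le_mul_of_nonneg_right (hR _ _) hl.1.le
  · rw [mul_comm]
    exact (mul_le_mul_of_nonneg_left (hu i j hij) hl.1.le).trans
      (hX.mul_dist_le_of_contraction hl.1.le hl.2 (hz p l hl i) (hz' p l hl i) (hz p l hl j)
        (hz' p l hl j))
  · rintro rfl
    simp at hd

theorem frontier_ball_nonempty [NoncompactSpace X] (hX : IsNonnegAlexandrovSpace X)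
    (hdim : dimH (univ : Set X) ≠ ⊤) (x₀ : X) {t : ℝ} (ht : 0 < t) :
    (frontier (Metric.ball x₀ t)).Nonempty := by
  obtain ⟨y, hy⟩ := hX.exists_dist_gt hdim x₀ t
  obtain ⟨z, hz, -⟩ := hX.exists_mem_sphere_between (x := x₀) (by simpa using ht.le) hy.le
  exact ⟨z, hX.sphere_subset_frontier x₀ ht hz⟩

end IsNonnegAlexandrovSpace

end

theorem proposition2p1 {X : Type*} [MetricSpace X] [NoncompactSpace X] (n : ℕ)
    (hdim : dimH (Set.univ : Set X) = (n : ENNReal))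
    (hX : IsNonnegAlexandrovSpace X) (x₀ : X) :
    -- the limit that defines `h` exists, through distances to non-empty spheres
    (∀ t : ℝ, 0 < t → (frontier (Metric.ball x₀ t)).Nonempty) ∧
    (∀ x : X, Tendsto (preBusemann x₀ x) atTop (𝓝 (busemann x₀ x))) ∧
    -- `h` is concave along quasi-geodesics, and along geodesics in particular
    (∀ (a b : ℝ) (σ : ℝ → X), IsQuasiGeodesicOn σ a b →
      ConcaveOn ℝ (Icc a b) (fun t => busemann x₀ (σ t))) ∧
    (∀ (a b : ℝ) (σ : ℝ → X), IsGeodesicOn σ a b →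
      ConcaveOn ℝ (Icc a b) (fun t => busemann x₀ (σ t))) ∧
    -- the superlevel sets of `h` are totally convex
    (∀ c : ℝ, IsTotallyConvex {x : X | c ≤ busemann x₀ x}) := by
  have hne : ∀ t : ℝ, 0 < t → (frontier (Metric.ball x₀ t)).Nonempty := fun t ht =>
    hX.frontier_ball_nonempty (by simp [hdim]) x₀ ht
  have hlim := hX.tendsto_preBusemann hne
  have hquasi : ∀ (a b : ℝ) (σ : ℝ → X), IsQuasiGeodesicOn σ a b →
      ConcaveOn ℝ (Icc a b) (fun t => busemann x₀ (σ t)) := fun a b σ hσ =>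
    concaveOn_busemann_comp hne hlim hσ.le
      (fun s hs => (hσ.unitSpeed.dist_le (left_mem_Icc.2 hσ.le) hs hs.1).trans
        (by linarith [hs.2]))
      (fun p hp x hx y hy hxy α β hα hβ hαβ => hσ.sq_dist_ge hp hx hy hxy hα hβ hαβ)
  refine ⟨hne, hlim, hquasi, fun a b σ hσ => ?_, fun c a b σ hσ ha hb t ht => ?_⟩
  · refine concaveOn_busemann_comp hne hlim hσ.1 (fun s hs => ?_)
      (fun p _ x hx y hy hxy α β hα hβ hαβ => hσ.sq_dist_ge hX p hx hy hxy hα hβ hαβ)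
    rw [hσ.2 a (left_mem_Icc.2 hσ.1) s hs, abs_of_nonpos (by linarith [hs.1])]
    linarith [hs.2]
  -- A concave function on an interval is at least its minimum over the endpoints.
  · exact (le_min ha hb).trans ((hquasi a b σ hσ).min_le_of_mem_Icc (left_mem_Icc.2 hσ.le)
      (right_mem_Icc.2 hσ.le) ht)
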